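/- Let $\mathbb T=\{z\in\mathbb C:|z|=1\}$. Call a set $B\subset\mathbb T^d$ *approximable* if $$\inf_P\ \sup_{z\in B}|1-P(z)|=0,$$ where $P$ ranges over the polynomials $P(z)=\sum_{m}h_m z^m$ (finite sums, $h_m\in\mathbb C$) in $d$ complex variables all of whose exponents $m=(m_1,\dots,m_d)$ satisfy $m_i\ge 1$ for every $i$. For $a\le b$ let $I_{a,b}=\{e^{i\theta}:a\le\theta\le b\}\subset\mathbb T$, let $\eta=1/100$, and put $\mathbb T^x=\mathbb T\setminus I_{x-\eta,x+\eta}$, $J_0=I_{-\pi/3,\pi/3}$, $J_\pi=I_{\pi-\pi/3,\pi+\pi/3}$. Let $S\subset\mathbb T^2$ be the set of all $(u,v)$ with $u\in\mathbb T^0$ and $$v\in\mathbb T^0\ \text{ if }u\in J_0,\qquad v\in\mathbb T^\pi\ \text{ if }u\in J_\pi,\qquad v\in\mathbb T^0\cap\mathbb T^\pi\ \text{ if }u\notin J_0\cup J_\pi .$$ **Proposition.** 1. The set $S$ is approximable. Moreover, for all continuous functions $\gamma_1,\gamma_2:\mathbb T\to\mathbb C$, $$\inf_{H}\ \sup_{(u,v)\in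 S}|\gamma_1(u)\gamma_2(v)-H(u,v)|=0,$$ where $H$ ranges over all complex polynomials in two variables. Nevertheless, $S$ is not contained in any simply connected subset of $\mathbb T^2$. 2. For every $d\ge 2$ there is a set in $\mathbb T^d$ that is approximable and that is not contained in any simply connected subset of $\mathbb T^d$. Here a subset of $\mathbb T^d$ is simply connected if, with the subspace topology, it is path-connected and every loop in it can be continuously deformed within it to a point. -/

import Mathlib

noncomputable section

/-- The `d`-dimensional torus `𝕋^d`, where `𝕋` is the unit circle of `ℂ`. -/
abbrev Torus (d : ℕ) : Type := Fin d → Circle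

/-- The value of a complex polynomial in `d` variables at a point of the torus `𝕋^d ⊂ ℂ^d`. -/
def polyEval {d : ℕ} (P : MvPolynomial (Fin d) ℂ) (z : Torus d) : ℂ :=
  MvPolynomial.eval (fun i => (z i : ℂ)) P

/-- The polynomials `∑_{m ∈ B} h_m z^m` (finite sums) with exponents in `B`. -/
def polyClass {d : ℕ} (B : Set (Fin d →₀ ℕ)) : Set (MvPolynomial (Fin d) ℂ) :=
  {P | ∀ m ∈ P.support, m ∈ B}

/-- The positive orthant: multi-indices all of whose coordinates are at least `1`. -/
def posOrthant (d : ℕ) : Set (Fin d →₀ ℕ) :=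
  {m | ∀ i, 1 ≤ m i}

/-- `B ⊂ 𝕋^d` is approximable: the constant `1` is a uniform limit on `B` of polynomials with
exponents in the positive orthant. -/
def Approximable {d : ℕ} (B : Set (Torus d)) : Prop :=
  ∀ ε : ℝ, 0 < ε → ∃ P ∈ polyClass (posOrthant d), ∀ z ∈ B, ‖1 - polyEval P z‖ ≤ ε

/-- The arc `I_{a,b} = {e^{iθ} : a ≤ θ ≤ b}` of the unit circle. -/
def arc (a b : ℝ) : Set Circle :=
  {w | ∃ θ : ℝ, a ≤ θ ∧ θ ≤ b ∧ w = Circle.exp θ}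

/-- `𝕋^x = 𝕋 \ I_{x-η,x+η}` with `η = 1/100`. -/
def cutCircle (x : ℝ) : Set Circle :=
  (arc (x - 1 / 100) (x + 1 / 100))ᶜ

/-- `J_0 = I_{-π/3,π/3}`. -/
def arcJ0 : Set Circle := arc (-(Real.pi / 3)) (Real.pi / 3)

/-- `J_π = I_{π-π/3,π+π/3}`. -/
def arcJpi : Set Circle := arc (Real.pi - Real.pi / 3) (Real.pi + Real.pi / 3)

/-- The set of all `(u, v) ∈ 𝕋²` with `u ∈ 𝕋^0` and: `v ∈ 𝕋^0` if `u ∈ J_0`; `v ∈ 𝕋^π` if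
`u ∈ J_π`; `v ∈ 𝕋^0 ∩ 𝕋^π` if `u` lies outside `J_0 ∪ J_π`. -/
def spectrumS : Set (Torus 2) :=
  {z | z 0 ∈ cutCircle 0 ∧
    (z 0 ∈ arcJ0 → z 1 ∈ cutCircle 0) ∧
    (z 0 ∈ arcJpi → z 1 ∈ cutCircle Real.pi) ∧
    (z 0 ∉ arcJ0 ∪ arcJpi → z 1 ∈ cutCircle 0 ∩ cutCircle Real.pi)}

end

/-! Multiplying by the unimodular product of the coordinates reduces approximability to
approximating its inverse, a product of functions of one variable, by arbitrary polynomials. On a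
proper closed subset of the circle polynomials are dense. On S, cut γ₁ with a partition of unity φ,
1 - φ in u: where φ(u) ≠ 0, u is off J_π, so v avoids an arc about 1; where 1 - φ(u) ≠ 0, v avoids
an arc about -1. One-variable density then handles each piece (`exists_polynomials_near_mul`). Yet S
contains a loop along which v runs once around the circle, so every A ⊇ S retracts onto a circle
through v. For larger d, pad with coordinates equal to 1. -/

/-- A space of which the circle is a retract is not simply connected. -/
theorem not_simplyConnectedSpace_of_circle_section {X : Type*} [TopologicalSpace X]
    (s : C(Circle, X)) (p : C(X, Circle)) (h : ∀ z, p (s z) = z) : ¬ SimplyConnectedSpace X := by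
  intro _
  let γ : Path (s 1) (s 1) :=
    { toFun := fun t => s (Circle.exp (2 * Real.pi * t))
      continuous_toFun := by fun_prop
      source' := by simp
      target' := by simp }
  have hγ := ContinuousMap.HomotopicRel.comp_continuousMap
    (SimplyConnectedSpace.paths_homotopic γ (Path.refl (s 1))) p
  let Γ₁ : C(unitInterval, ℝ) := ⟨fun t => 2 * Real.pi * t, by fun_prop⟩
  -- Lifts from 0 of homotopic loops end at the same point, but here the ends are 2π and 0.
  have key := Circle.isCoveringMap_exp.liftPath_apply_one_eq_of_homotopicRel hγ 0
    (by simp [h]) (by simp [h])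
  rw [← (Circle.isCoveringMap_exp.eq_liftPath_iff' (Γ := Γ₁) _).mpr,
    ← (Circle.isCoveringMap_exp.eq_liftPath_iff' (Γ := .const _ 0) _).mpr] at key
  · simp [Γ₁] at key
  · refine ⟨?_, rfl⟩
    ext t
    simp [h]
  · refine ⟨?_, by simp [Γ₁]⟩
    funext t
    simp [h, γ, Γ₁]

/-! ### Polynomial density on proper closed subsets of the circle -/

open Filter Topology in
/-- The inverse of `1 - u` lies in the closed algebra generated by an element `u` of the closed
unit ball: it is a limit of Cesàro means of the geometric series. -/
theorem mem_topologicalClosure_adjoin_of_one_sub_mul_eq_one {R : Type*} [NormedCommRing R]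
    [NormOneClass R] [NormedAlgebra ℂ R] {u g : R} (hu : ‖u‖ ≤ 1) (h : (1 - u) * g = 1) :
    g ∈ (Algebra.adjoin ℂ {u}).topologicalClosure := by
  let C : ℕ → R := fun n =>
    ((n : ℂ) + 1)⁻¹ • ∑ k ∈ Finset.range (n + 1), ∑ j ∈ Finset.range (k + 1), u ^ j
  have hmem : u ∈ Algebra.adjoin ℂ {u} := Algebra.subset_adjoin rfl
  have hC : ∀ n, C n ∈ Algebra.adjoin ℂ {u} := fun n =>
    Subalgebra.smul_mem _ (sum_mem fun k _ => sum_mem fun j _ => pow_mem hmem j) _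
  have hgeom : ∀ m, ∑ j ∈ Finset.range m, u ^ j = (1 - u ^ m) * g := fun m => by
    rw [← mul_neg_geom_sum, mul_right_comm, h, one_mul]
  -- As ‖u‖ = 1 is allowed, the partial sums (1 - u^m)g need not converge; averaging leaves an error
  -- O(1/n).
  have hdiff : ∀ n, C n - g = -(((n : ℂ) + 1)⁻¹ • (u * (1 - u ^ (n + 1)) * g * g)) := by
    intro n
    have hn : ((n : ℂ) + 1) ≠ 0 := by exact_mod_cast n.succ_ne_zero
    have : ∑ k ∈ Finset.range (n + 1), ∑ j ∈ Finset.range (k + 1), u ^ j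
        = ((n : ℂ) + 1) • g - u * (1 - u ^ (n + 1)) * g * g := by
      simp_rw [hgeom, sub_mul, one_mul, pow_succ', Finset.sum_sub_distrib, ← Finset.sum_mul,
        ← Finset.mul_sum, hgeom, pow_succ']
      simp only [Finset.sum_const, Finset.card_range, sub_mul, mul_sub]
      congr 1
      · rw [← Nat.cast_smul_eq_nsmul ℂ]; push_cast; rfl
      · ring
    simp only [C, this, smul_sub, inv_smul_smul₀ hn]
    abel
  have hlim : Tendsto C atTop (𝓝 g) := by
    rw [tendsto_iff_norm_sub_tendsto_zero]
    refine squeeze_zero (fun _ => norm_nonneg _)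
      (g := fun n : ℕ => 1 / ((n : ℝ) + 1) * (2 * ‖g‖ * ‖g‖)) (fun n => ?_)
      (by
        simpa using (tendsto_one_div_add_atTop_nhds_zero_nat (𝕜 := ℝ)).mul_const
          (2 * ‖g‖ * ‖g‖))
    have hpow : ‖u ^ (n + 1)‖ ≤ 1 :=
      (norm_pow_le _ _).trans (pow_le_one₀ (norm_nonneg _) hu)
    have h2 : ‖1 - u ^ (n + 1)‖ ≤ 2 := (norm_sub_le _ _).trans (by rw [norm_one]; linarith)
    rw [hdiff, norm_neg, norm_smul, norm_inv, one_div]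
    have hcast : ‖(n : ℂ) + 1‖ = (n : ℝ) + 1 := by exact_mod_cast Complex.norm_natCast (n + 1)
    rw [hcast]
    gcongr
    refine (norm_mul_le _ _).trans ?_
    gcongr
    refine (norm_mul_le _ _).trans ?_
    gcongr
    refine (norm_mul_le _ _).trans ?_
    calc ‖u‖ * ‖1 - u ^ (n + 1)‖ ≤ 1 * 2 := by gcongr
      _ = 2 := one_mul 2
  exact mem_closure_of_tendsto hlim (Eventually.of_forall hC)

/-- On a proper closed subset of the circle, the polynomials are uniformly dense in the continuous
functions. -/
theorem exists_polynomial_near_of_isClosed_circle {K : Set Circle} (hK : IsClosed K) {z₀ : Circle}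
    (hz₀ : z₀ ∉ K) {f : Circle → ℂ} (hf : Continuous f) {ε : ℝ} (hε : 0 < ε) :
    ∃ p : Polynomial ℂ, ∀ w ∈ K, ‖f w - p.eval (w : ℂ)‖ ≤ ε := by
  have : CompactSpace K := isCompact_iff_compactSpace.mp hK.isCompact
  rcases K.eq_empty_or_nonempty with rfl | hne
  · exact ⟨0, by simp⟩
  have : Nonempty K := hne.to_subtype
  let ι : C(K, ℂ) := ⟨fun w => ((w : Circle) : ℂ), by fun_prop⟩
  -- This rotation moves the missing point to 1, so 1 - u has no zero on K.
  let c : ℂ := ((z₀⁻¹ : Circle) : ℂ)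
  let u : C(K, ℂ) := c • ι
  have hu : ∀ w : K, u w = ((z₀⁻¹ * (w : Circle) : Circle) : ℂ) := fun w => by
    rw [Circle.coe_mul]; rfl
  have hu1 : ∀ w : K, 1 - u w ≠ 0 := by
    intro w hw
    have : z₀⁻¹ * (w : Circle) = 1 := by
      ext
      rw [← hu, Circle.coe_one, ← sub_eq_zero.mp hw]
    exact hz₀ (by rw [inv_mul_eq_one.mp this]; exact w.2)
  let g : C(K, ℂ) := ⟨fun w => (1 - u w)⁻¹, by fun_prop (disch := exact hu1)⟩
  have hug : (1 - u) * g = 1 := by ext w; simp [g, mul_inv_cancel₀ (hu1 w)]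
  have hun : ‖u‖ ≤ 1 := (ContinuousMap.norm_le _ zero_le_one).mpr fun w => by
    rw [hu, Circle.norm_coe]
  -- Since |u| = 1, 1/(1 - ū) = -u/(1 - u) = 1 - g. Hence the algebra generated by g is closed under
  -- conjugation and Stone–Weierstrass applies.
  have hstar : star g = 1 - g := by
    ext w
    have hnorm : u w * star (u w) = 1 := by
      rw [hu, Complex.star_def, Complex.mul_conj, Circle.normSq_coe, Complex.ofReal_one]
    have hstar1 : 1 - star (u w) ≠ 0 := by
      simpa [star_sub] using (star_ne_zero.mpr (hu1 w))
    simp only [ContinuousMap.star_apply, ContinuousMap.sub_apply, ContinuousMap.one_apply, g,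
      ContinuousMap.coe_mk, star_inv₀, star_sub, star_one]
    have := hu1 w
    field_simp
    linear_combination -hnorm
  let A := (Algebra.adjoin ℂ {ι}).topologicalClosure
  have hgA : g ∈ A := by
    have hle : Algebra.adjoin ℂ {u} ≤ Algebra.adjoin ℂ {ι} := Algebra.adjoin_le <|
      Set.singleton_subset_iff.mpr <| show c • ι ∈ _ from
        Subalgebra.smul_mem _ (Algebra.self_mem_adjoin_singleton ℂ ι) c
    exact closure_mono (SetLike.coe_subset_coe.mpr hle)
      (mem_topologicalClosure_adjoin_of_one_sub_mul_eq_one hun hug)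
  have hsep : (StarAlgebra.adjoin ℂ {g}).SeparatesPoints := by
    intro x y hxy
    refine ⟨g, ⟨g, StarAlgebra.self_mem_adjoin_singleton ℂ g, rfl⟩, fun hg => hxy ?_⟩
    have : c * ι x = c * ι y := by simpa [g, u] using hg
    exact Subtype.ext (Circle.ext (mul_left_cancel₀ (Circle.coe_ne_zero _) this))
  have htop := ContinuousMap.starSubalgebra_topologicalClosure_eq_top_of_separatesPoints _ hsep
  have hle : (StarAlgebra.adjoin ℂ {g}).toSubalgebra ≤ A := by
    rw [StarAlgebra.adjoin_toSubalgebra]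
    refine Algebra.adjoin_le ?_
    rintro x (hx | hx)
    · rw [Set.mem_singleton_iff.mp hx]; exact hgA
    · rw [Set.star_singleton, hstar] at hx
      rw [Set.mem_singleton_iff.mp hx]; exact sub_mem (one_mem _) hgA
  let F : C(K, ℂ) := ⟨fun w => f w, by fun_prop⟩
  have hF : F ∈ closure (Algebra.adjoin ℂ {ι} : Set C(K, ℂ)) := by
    have h1 : F ∈ closure (StarAlgebra.adjoin ℂ {g} : Set C(K, ℂ)) := by
      rw [← StarSubalgebra.topologicalClosure_coe, htop]
      trivial
    exact closure_minimal (show (StarAlgebra.adjoin ℂ {g} : Set C(K, ℂ)) ⊆ A from hle)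
      (Subalgebra.isClosed_topologicalClosure _) h1
  obtain ⟨q, hq, hFq⟩ := Metric.mem_closure_iff.mp hF ε hε
  obtain ⟨p, rfl⟩ := Algebra.adjoin_mem_exists_aeval ℂ ι hq
  refine ⟨p, fun w hw => ?_⟩
  have h1 := (ContinuousMap.dist_apply_le_dist (f := F) (g := Polynomial.aeval ι p)
    ⟨w, hw⟩).trans hFq.le
  rw [dist_eq_norm] at h1
  have h2 : (Polynomial.aeval ι p) ⟨w, hw⟩ = p.eval (w : ℂ) := by
    simp [ι]
  rwa [h2] at h1
theorem exp_notMem_closure_cutCircle (x : ℝ) : Circle.exp x ∉ closure (cutCircle x) := by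
  rw [cutCircle, closure_compl, Set.notMem_compl_iff, mem_interior]
  refine ⟨Circle.exp '' Set.Ioo (x - 1 / 100) (x + 1 / 100), ?_,
    Circle.isCoveringMap_exp.isLocalHomeomorph.isOpenMap _ isOpen_Ioo, x,
    by constructor <;> norm_num, rfl⟩
  rintro _ ⟨θ, ⟨h₁, h₂⟩, rfl⟩
  exact ⟨θ, h₁.le, h₂.le, rfl⟩

/-- Polynomials are uniformly dense in the continuous functions on a circle with an arc removed. -/
theorem exists_polynomial_near_on_cutCircle (x : ℝ) {f : Circle → ℂ} (hf : Continuous f) {ε : ℝ}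
    (hε : 0 < ε) : ∃ p : Polynomial ℂ, ∀ w ∈ cutCircle x, ‖f w - p.eval (w : ℂ)‖ ≤ ε := by
  obtain ⟨p, hp⟩ := exists_polynomial_near_of_isClosed_circle isClosed_closure
    (exp_notMem_closure_cutCircle x) hf hε
  exact ⟨p, fun w hw => hp w (subset_closure hw)⟩

theorem Circle.exists_norm_le_of_continuous {f : Circle → ℂ} (hf : Continuous f) :
    ∃ M : ℝ, 0 < M ∧ ∀ w, ‖f w‖ ≤ M := by
  obtain ⟨M, hM⟩ := isCompact_univ.exists_bound_of_continuousOn hf.continuousOn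
  exact ⟨max M 1, by positivity, fun w => (hM w trivial).trans (le_max_left _ _)⟩

/-- If `a(u) b(v)` is a product such that `b` can be approximated on the fibres over the points
where `a` does not vanish, then it can be approximated by products of polynomials. -/
theorem exists_polynomials_near_mul (x : ℝ) {a b : Circle → ℂ} (ha : Continuous a)
    (hb : Continuous b) {ε : ℝ} (hε : 0 < ε) :
    ∃ p q : Polynomial ℂ, ∀ u ∈ cutCircle 0, ∀ v, (a u ≠ 0 → v ∈ cutCircle x) →
      ‖a u * b v - p.eval (u : ℂ) * q.eval (v : ℂ)‖ ≤ ε := by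
  obtain ⟨M, hM, haM⟩ := Circle.exists_norm_le_of_continuous ha
  -- q comes first: the tolerance for p depends on N, which bounds q on the whole circle because v
  -- is unrestricted where a vanishes.
  obtain ⟨q, hq⟩ := exists_polynomial_near_on_cutCircle x hb (ε := ε / (2 * M)) (by positivity)
  obtain ⟨N, hN, hqN⟩ := Circle.exists_norm_le_of_continuous
    (f := fun w => q.eval (w : ℂ)) (by fun_prop)
  obtain ⟨p, hp⟩ := exists_polynomial_near_on_cutCircle 0 ha (ε := ε / (2 * N)) (by positivity)
  refine ⟨p, q, fun u hu v hv => ?_⟩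
  have h₁ : ‖a u * (b v - q.eval (v : ℂ))‖ ≤ ε / 2 := by
    rcases eq_or_ne (a u) 0 with h | h
    · rw [h, zero_mul, norm_zero]; positivity
    · calc _ ≤ M * (ε / (2 * M)) := by
            rw [norm_mul]; gcongr; exacts [haM u, hq v (hv h)]
        _ = ε / 2 := by field_simp
  have h₂ : ‖(a u - p.eval (u : ℂ)) * q.eval (v : ℂ)‖ ≤ ε / 2 :=
    calc _ ≤ ε / (2 * N) * N := by
            rw [norm_mul]; gcongr; exacts [hp u hu, hqN v]
      _ = ε / 2 := by field_simp
  calc _ = ‖a u * (b v - q.eval (v : ℂ)) + (a u - p.eval (u : ℂ)) * q.eval (v : ℂ)‖ := by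
        congr 1; ring
    _ ≤ ε / 2 + ε / 2 := norm_add_le_of_le h₁ h₂
    _ = ε := add_halves ε

/-! ### Arcs seen through real parts -/

theorem Circle.re_exp (θ : ℝ) : ((Circle.exp θ : Circle) : ℂ).re = Real.cos θ := by
  rw [Circle.coe_exp, Complex.exp_ofReal_mul_I_re]

theorem half_le_re_of_mem_arcJ0 {u : Circle} (hu : u ∈ arcJ0) : 1 / 2 ≤ (u : ℂ).re := by
  obtain ⟨θ, h₁, h₂, rfl⟩ := hu
  rw [Circle.re_exp, ← Real.cos_abs, ← Real.cos_pi_div_three]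
  have := Real.pi_pos
  exact Real.cos_le_cos_of_nonneg_of_le_pi (abs_nonneg θ) (by linarith) (abs_le.mpr ⟨h₁, h₂⟩)

theorem re_le_neg_half_of_mem_arcJpi {u : Circle} (hu : u ∈ arcJpi) : (u : ℂ).re ≤ -(1 / 2) := by
  obtain ⟨θ, h₁, h₂, rfl⟩ := hu
  have h := half_le_re_of_mem_arcJ0 (u := Circle.exp (θ - Real.pi))
    ⟨_, by linarith, by linarith, rfl⟩
  rw [Circle.re_exp, Real.cos_sub_pi] at h
  rw [Circle.re_exp]
  linarith

theorem re_ge_of_mem_arc_zero {v : Circle} (hv : v ∈ arc (0 - 1 / 100) (0 + 1 / 100)) :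
    99 / 100 ≤ (v : ℂ).re := by
  obtain ⟨θ, h₁, h₂, rfl⟩ := hv
  rw [Circle.re_exp]
  nlinarith [Real.one_sub_sq_div_two_le_cos (x := θ)]

theorem re_le_of_mem_arc_pi {v : Circle}
    (hv : v ∈ arc (Real.pi - 1 / 100) (Real.pi + 1 / 100)) : (v : ℂ).re ≤ -(99 / 100) := by
  obtain ⟨θ, h₁, h₂, rfl⟩ := hv
  have h := re_ge_of_mem_arc_zero (v := Circle.exp (θ - Real.pi))
    ⟨_, by linarith, by linarith, rfl⟩
  rw [Circle.re_exp, Real.cos_sub_pi] at h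
  rw [Circle.re_exp]
  linarith

theorem mem_cutCircle_zero_of_mem_spectrumS {z : Torus 2} (hz : z ∈ spectrumS)
    (h : z 0 ∉ arcJpi) : z 1 ∈ cutCircle 0 := by
  by_cases h0 : z 0 ∈ arcJ0
  · exact hz.2.1 h0
  · exact (hz.2.2.2 (by simp [h0, h])).1

theorem mem_cutCircle_pi_of_mem_spectrumS {z : Torus 2} (hz : z ∈ spectrumS)
    (h : z 0 ∉ arcJ0) : z 1 ∈ cutCircle Real.pi := by
  by_cases h0 : z 0 ∈ arcJpi
  · exact hz.2.2.1 h0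
  · exact (hz.2.2.2 (by simp [h0, h])).2

/-! ### Approximation on S -/

theorem polyEval_aeval_X {d : ℕ} (p : Polynomial ℂ) (i : Fin d) (z : Torus d) :
    polyEval (Polynomial.aeval (MvPolynomial.X i) p) z = p.eval (z i : ℂ) := by
  rw [polyEval, ← MvPolynomial.coe_aeval_eq_eval, RingHom.coe_coe,
    ← Polynomial.aeval_algHom_apply, MvPolynomial.aeval_X, Polynomial.coe_aeval_eq_eval]

/-- Products `γ₁(u) γ₂(v)` of continuous functions are uniform limits of polynomials on the set
`spectrumS`. -/
theorem exists_polynomial_near_on_spectrumS {γ₁ γ₂ : Circle → ℂ} (h₁ : Continuous γ₁)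
    (h₂ : Continuous γ₂) {ε : ℝ} (hε : 0 < ε) : ∃ H : MvPolynomial (Fin 2) ℂ,
      ∀ z ∈ spectrumS, ‖γ₁ (z 0) * γ₂ (z 1) - polyEval H z‖ ≤ ε := by
  -- A cutoff equal to 1 on J_0, where Re u ≥ 1/2, and to 0 on J_π, where Re u ≤ -1/2.
  let φ : Circle → ℝ := fun u => max 0 (min 1 ((u : ℂ).re + 1 / 2))
  have hφ : Continuous φ := by fun_prop
  have hφpi : ∀ u ∈ arcJpi, φ u = 0 := fun u hu => by
    have := re_le_neg_half_of_mem_arcJpi hu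
    exact max_eq_left ((min_le_right _ _).trans (by linarith))
  have hφ0 : ∀ u ∈ arcJ0, φ u = 1 := fun u hu => by
    have := half_le_re_of_mem_arcJ0 hu
    simp only [φ]
    rw [min_eq_left (by linarith), max_eq_right zero_le_one]
  obtain ⟨p₁, q₁, hpq₁⟩ := exists_polynomials_near_mul 0 (a := fun u => (φ u : ℂ) * γ₁ u)
    (by fun_prop) h₂ (half_pos hε)
  obtain ⟨p₂, q₂, hpq₂⟩ := exists_polynomials_near_mul Real.pi
    (a := fun u => (1 - φ u : ℂ) * γ₁ u) (by fun_prop) h₂ (half_pos hε)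
  let X (i : Fin 2) : MvPolynomial (Fin 2) ℂ := MvPolynomial.X i
  refine ⟨Polynomial.aeval (X 0) p₁ * Polynomial.aeval (X 1) q₁ +
    Polynomial.aeval (X 0) p₂ * Polynomial.aeval (X 1) q₂, fun z hz => ?_⟩
  have e₁ := hpq₁ (z 0) hz.1 (z 1) fun h => mem_cutCircle_zero_of_mem_spectrumS hz fun hu => by
    simp [hφpi _ hu] at h
  have e₂ := hpq₂ (z 0) hz.1 (z 1) fun h => mem_cutCircle_pi_of_mem_spectrumS hz fun hu => by
    simp [hφ0 _ hu] at h
  have hH : polyEval (Polynomial.aeval (X 0) p₁ * Polynomial.aeval (X 1) q₁ +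
      Polynomial.aeval (X 0) p₂ * Polynomial.aeval (X 1) q₂) z =
      p₁.eval (z 0 : ℂ) * q₁.eval (z 1 : ℂ) + p₂.eval (z 0 : ℂ) * q₂.eval (z 1 : ℂ) := by
    simp only [← polyEval_aeval_X, X]
    simp only [polyEval, map_add, map_mul]
  rw [hH]
  calc _ = _ := by congr 1; ring
    _ ≤ ε / 2 + ε / 2 := norm_add_le_of_le e₁ e₂
    _ = ε := add_halves ε

theorem prod_X_mul_mem_polyClass_posOrthant {d : ℕ} (H : MvPolynomial (Fin d) ℂ) :
    (∏ i, MvPolynomial.X i) * H ∈ polyClass (posOrthant d) := by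
  intro m hm i
  have hdvd : MvPolynomial.X i ∣ (∏ i, MvPolynomial.X i) * H :=
    (Finset.dvd_prod_of_mem _ (Finset.mem_univ i)).mul_right H
  obtain ⟨q, hq⟩ := hdvd
  rw [hq, MvPolynomial.support_X_mul, Finset.mem_map] at hm
  obtain ⟨m', -, rfl⟩ := hm
  simp

/-- A set is approximable if the inverse of the product of the coordinates is on it a uniform limit
of polynomials. -/
theorem approximable_of_inv_prod {d : ℕ} {B : Set (Torus d)}
    (h : ∀ ε : ℝ, 0 < ε → ∃ H : MvPolynomial (Fin d) ℂ, ∀ z ∈ B,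
      ‖(((∏ i, z i)⁻¹ : Circle) : ℂ) - polyEval H z‖ ≤ ε) : Approximable B := by
  intro ε hε
  obtain ⟨H, hH⟩ := h ε hε
  refine ⟨_, prod_X_mul_mem_polyClass_posOrthant H, fun z hz => ?_⟩
  have hprod : polyEval (∏ i, MvPolynomial.X i) z = ((∏ i, z i : Circle) : ℂ) := by
    simp only [polyEval, map_prod, MvPolynomial.eval_X]
    exact (map_prod Circle.coeHom z Finset.univ).symm
  have e : 1 - polyEval ((∏ i, MvPolynomial.X i) * H) z = ((∏ i, z i : Circle) : ℂ) *
      ((((∏ i, z i)⁻¹ : Circle) : ℂ) - polyEval H z) := by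
    rw [mul_sub, ← Circle.coe_mul, mul_inv_cancel, Circle.coe_one, ← hprod]
    simp only [polyEval, map_mul]
  rw [e, norm_mul, Circle.norm_coe, one_mul]
  exact hH z hz

theorem exists_polynomial_near_inv_prod_on_spectrumS {ε : ℝ} (hε : 0 < ε) :
    ∃ H : MvPolynomial (Fin 2) ℂ, ∀ z ∈ spectrumS,
      ‖(((∏ i, z i)⁻¹ : Circle) : ℂ) - polyEval H z‖ ≤ ε := by
  obtain ⟨H, hH⟩ := exists_polynomial_near_on_spectrumS (γ₁ := fun u => ((u⁻¹ : Circle) : ℂ))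
    (γ₂ := fun v => ((v⁻¹ : Circle) : ℂ)) (by fun_prop) (by fun_prop) hε
  refine ⟨H, fun z hz => ?_⟩
  rw [Fin.prod_univ_two, mul_inv, Circle.coe_mul]
  exact hH z hz

theorem approximable_spectrumS : Approximable spectrumS :=
  approximable_of_inv_prod fun _ => exists_polynomial_near_inv_prod_on_spectrumS

/-! ### The essential loop and higher dimensions -/

/-- The loop `v ↦ (e^{i(π/2 + (π/3) Re v)}, v)` winds once around the second factor of the torus
and stays in `spectrumS`. -/
noncomputable def spectrumLoop (v : Circle) : Torus 2 :=
  ![Circle.exp (Real.pi / 2 + Real.pi / 3 * (v : ℂ).re), v]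

theorem continuous_spectrumLoop : Continuous spectrumLoop := by
  refine continuous_pi fun i => ?_
  fin_cases i
  · change Continuous fun v : Circle => Circle.exp (Real.pi / 2 + Real.pi / 3 * (v : ℂ).re)
    fun_prop
  · exact continuous_id

/-- The angle of u stays in [π/6, 5π/6], so Re u ≤ √3/2 < 99/100. When v is near 1, u lies in J_π,
where that is allowed; when v is near -1, u lies in J_0. -/
theorem spectrumLoop_mem (v : Circle) : spectrumLoop v ∈ spectrumS := by
  have hπ := Real.pi_pos
  have hv : |(v : ℂ).re| ≤ 1 := (Complex.abs_re_le_norm _).trans (Circle.norm_coe v).le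
  obtain ⟨hv₁, hv₂⟩ := abs_le.mp hv
  have hre : ((Circle.exp (Real.pi / 2 + Real.pi / 3 * (v : ℂ).re) : Circle) : ℂ).re =
      -Real.sin (Real.pi / 3 * (v : ℂ).re) := by
    rw [Circle.re_exp, add_comm, Real.cos_add_pi_div_two]
  refine ⟨fun h => ?_, fun h h' => ?_, fun h h' => ?_, fun h => ⟨fun h' => h ?_, fun h' => h ?_⟩⟩
  · have h1 := re_ge_of_mem_arc_zero h
    change _ ≤ ((Circle.exp (Real.pi / 2 + Real.pi / 3 * (v : ℂ).re) : Circle) : ℂ).re at h1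
    rw [Circle.re_exp] at h1
    have h2 := Real.cos_le_cos_of_nonneg_of_le_pi (x := Real.pi / 6)
      (y := Real.pi / 2 + Real.pi / 3 * (v : ℂ).re) (by positivity) (by nlinarith) (by nlinarith)
    rw [Real.cos_pi_div_six] at h2
    nlinarith [Real.sq_sqrt (show (0 : ℝ) ≤ 3 by norm_num), Real.sqrt_nonneg 3]
  · have h1 := half_le_re_of_mem_arcJ0 h
    have h2 := re_ge_of_mem_arc_zero h'
    change _ ≤ (v : ℂ).re at h2
    change _ ≤ ((Circle.exp (Real.pi / 2 + Real.pi / 3 * (v : ℂ).re) : Circle) : ℂ).re at h1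
    rw [hre] at h1
    have := Real.sin_nonneg_of_nonneg_of_le_pi (x := Real.pi / 3 * (v : ℂ).re) (by nlinarith)
      (by nlinarith)
    linarith
  · have h1 := re_le_neg_half_of_mem_arcJpi h
    have h2 := re_le_of_mem_arc_pi h'
    change (v : ℂ).re ≤ _ at h2
    change ((Circle.exp (Real.pi / 2 + Real.pi / 3 * (v : ℂ).re) : Circle) : ℂ).re ≤ _ at h1
    rw [hre] at h1
    have := Real.sin_nonpos_of_nonpos_of_neg_pi_le (x := Real.pi / 3 * (v : ℂ).re) (by nlinarith)
      (by nlinarith)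
    linarith
  · have h2 := re_ge_of_mem_arc_zero h'
    change _ ≤ (v : ℂ).re at h2
    exact Or.inr ⟨_, by nlinarith, by nlinarith, rfl⟩
  · have h2 := re_le_of_mem_arc_pi h'
    change (v : ℂ).re ≤ _ at h2
    exact Or.inl ⟨_, by nlinarith, by nlinarith, rfl⟩

/-- A subset of a torus that contains a continuous section of a coordinate projection is not simply
connected. -/
theorem not_isSimplyConnected_of_section {d : ℕ} (i : Fin d) {s : Circle → Torus d}
    (hs : Continuous s) (h : ∀ v, s v i = v) {A : Set (Torus d)} (hA : ∀ v, s v ∈ A) :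
    ¬ IsSimplyConnected A :=
  not_simplyConnectedSpace_of_circle_section ⟨fun v => (⟨s v, hA v⟩ : A), by fun_prop⟩
    ⟨fun z => (z : Torus d) i, (continuous_apply i).comp continuous_subtype_val⟩ h

/-- The set of the points of `𝕋^{n+2}` that project into `spectrumS` and whose other coordinates
are equal to `1`. -/
def spectrumExtension (n : ℕ) : Set (Torus (n + 2)) :=
  {z | (fun i => z (Fin.natAdd n i)) ∈ spectrumS ∧ ∀ i, z (Fin.castAdd 2 i) = 1}

theorem approximable_spectrumExtension (n : ℕ) : Approximable (spectrumExtension n) := by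
  refine approximable_of_inv_prod fun ε hε => ?_
  obtain ⟨H, hH⟩ := exists_polynomial_near_inv_prod_on_spectrumS hε
  refine ⟨MvPolynomial.rename (Fin.natAdd n) H, fun z hz => ?_⟩
  have h := hH _ hz.1
  rw [Fin.prod_univ_add, Finset.prod_eq_one fun i _ => hz.2 i, one_mul]
  rwa [polyEval, MvPolynomial.eval_rename]

theorem mainTheorem10 :
    (Approximable spectrumS ∧
      (∀ γ₁ γ₂ : Circle → ℂ, Continuous γ₁ → Continuous γ₂ →
        ∀ ε : ℝ, 0 < ε → ∃ H : MvPolynomial (Fin 2) ℂ,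
          ∀ z ∈ spectrumS, ‖γ₁ (z 0) * γ₂ (z 1) - polyEval H z‖ ≤ ε) ∧
      (∀ A : Set (Torus 2), spectrumS ⊆ A → ¬ IsSimplyConnected A)) ∧
    (∀ d : ℕ, 2 ≤ d → ∃ S : Set (Torus d), Approximable S ∧
      ∀ A : Set (Torus d), S ⊆ A → ¬ IsSimplyConnected A) := by
  refine ⟨⟨approximable_spectrumS, fun γ₁ γ₂ h₁ h₂ ε hε =>
    exists_polynomial_near_on_spectrumS h₁ h₂ hε, fun A hA =>
    not_isSimplyConnected_of_section 1 continuous_spectrumLoop (fun _ => rfl)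
      fun v => hA (spectrumLoop_mem v)⟩, fun d hd => ?_⟩
  obtain ⟨n, rfl⟩ := Nat.exists_eq_add_of_le' hd
  refine ⟨spectrumExtension n, approximable_spectrumExtension n, fun A hA =>
    -- The last coordinate is v, the one that the loop winds around.
    not_isSimplyConnected_of_section (Fin.natAdd n 1)
      (s := fun v => Fin.append (fun _ => 1) (spectrumLoop v)) ?_ (fun v => ?_)
      fun v => hA ⟨?_, fun i => ?_⟩⟩
  · refine continuous_pi fun i => ?_
    refine Fin.addCases (fun j => ?_) (fun j => ?_) i
    · simpa only [Fin.append_left] using continuous_const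
    · simpa only [Fin.append_right] using (continuous_pi_iff.mp continuous_spectrumLoop) j
  · rw [Fin.append_right]; rfl
  · simpa only [Fin.append_right] using spectrumLoop_mem v
  · rw [Fin.append_left]
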